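/- Theorem. Let $0\le k\le n$ be integers, and let $\mathsf{U}_{k,n}$ be the uniform matroid of rank $k$ on $n$ elements, whose bases are all $k$-element subsets of $\{1,\dots,n\}$. For a matroid $\mathsf{M}$ let $\mathcal{L}(\mathsf{M})$ be its lattice of flats, and for a flat $F$ let $\mathsf{M}_F$ be the contraction by $F$ and $\mathsf{M}^F$ the restriction to $F$. Let $\chi_{\mathsf{M}}$ be the characteristic polynomial of $\mathcal{L}(\mathsf{M})$ (with $\chi_{\mathsf{M}}=0$ if $\mathsf{M}$ has a loop). Let $P_{\mathsf{M}}(t)\in\mathbb{Z}[t]$ be the Kazhdan--Lusztig polynomial, i.e. the unique assignment such that (1) if $\operatorname{rk}(\mathsf{M})=0$ then $P_{\mathsf{M}}=1$ when $\mathsf{M}$ is empty and $P_{\mathsf{M}}=0$ otherwise; (2) if $\operatorname{rk}(\mathsf{M})>0$ then $\deg P_{\mathsf{M}}<\operatorname{rk}(\mathsf{M})/2$; (3) $t^{\operatorname{rk}(\mathsf{M})}P_{\mathsf{M}}(t^{-1})=\sum_{F\in\mathcal{L}(\mathsf{M})}\chi_{\mathsf{M}^F}(t)\,P_{\mathsf{M}_F}(t)$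 for every $\mathsf{M}$. Let $Z_{\mathsf{M}}(t)=\sum_{F\in\mathcal{L}(\mathsf{M})}t^{\operatorname{rk}(F)}P_{\mathsf{M}_F}(t)$. This is a palindromic polynomial of degree $d=\operatorname{rk}(\mathsf{M})$, and the $\gamma$-polynomial of $\mathsf{M}$ is the polynomial $\gamma_{\mathsf{M}}(t)=\sum_{i=0}^{\lfloor d/2\rfloor}\gamma_i t^i\in\mathbb{Z}[t]$ determined by $$Z_{\mathsf{M}}(t)=\sum_{i=0}^{\lfloor d/2\rfloor}\gamma_i\,t^i(1+t)^{d-2i}.$$ Then $\mathsf{U}_{k,n}$ is $\gamma$-positive, i.e. all coefficients of $\gamma_{\mathsf{U}_{k,n}}(t)$ are non-negative. Moreover $\gamma_{\mathsf{U}_{k,n}}$ has degree at most $\lfloor k/2\rfloor$, its constant term is $1$, and for every integer $i$ with $0<i<k$ its $i$-th coefficient is $$[t^i]\gamma_{\mathsf{U}_{k,n}}(t)=\frac{1}{k-i}\binom{k-i}{i}\sum_{j=i}^{k-1}(k-j)\binom{j-1}{i-1}\binom{n-k+j-1}{j}.$$ -/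

import Mathlib

open Polynomial

namespace Matroid

section Invariants

variable {α : Type*} [Finite α]

/-- The flats of `M`, partially ordered by inclusion. -/
abbrev Flats (M : Matroid α) : Type _ := {F : Set α // M.IsFlat F}

noncomputable instance (M : Matroid α) : Fintype (Flats M) := Fintype.ofFinite _

open Classical in
noncomputable instance (M : Matroid α) : LocallyFiniteOrder (Flats M) :=
  Fintype.toLocallyFiniteOrder

/-- The rank of a set, as a natural number. -/
noncomputable def rkSet (M : Matroid α) (A : Set α) : ℕ := (M.eRk A).toNat

/-- The rank of a matroid, as a natural number. -/
noncomputable def rkTop (M : Matroid α) : ℕ := M.rkSet M.E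

/-- The smallest flat, i.e. the flat spanned by the empty set. -/
def botFlat (M : Matroid α) : Flats M := ⟨M.closure ∅, M.isFlat_closure ∅⟩

open Classical in
/-- The characteristic polynomial of the lattice of flats,
`χ_M(t) = ∑_F μ(⊥, F) t ^ (rk M - rk F)`, with the usual convention that it is `0` when `M` has
loops. -/
noncomputable def charPoly (M : Matroid α) : ℤ[X] :=
  if M.Loopless then
    ∑ F : Flats M, C (IncidenceAlgebra.mu ℤ M.botFlat F) * X ^ (M.rkTop - M.rkSet F.1)
  else 0

/-- The three conditions that characterize the Kazhdan-Lusztig polynomials of matroids. Here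
`reflect r p` is `t ^ r * p(t⁻¹)`, the contraction `M ／ F` is `M_F` and the restriction `M ↾ F`
is the localization `M^F`. -/
structure IsKazhdanLusztig (P : Matroid α → ℤ[X]) : Prop where
  rank_zero : ∀ M : Matroid α, M.rkTop = 0 → (M.E = ∅ → P M = 1) ∧ (M.E ≠ ∅ → P M = 0)
  degree_lt : ∀ M : Matroid α, 0 < M.rkTop → 2 * (P M).natDegree < M.rkTop
  reciprocity : ∀ M : Matroid α,
    reflect M.rkTop (P M) = ∑ F : Flats M, charPoly (M ↾ F.1) * P (M ／ F.1)

lemma ncard_contract_ground_lt (M : Matroid α) {F : Set α} (hF : M.IsFlat F) (hne : F ≠ ∅) :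
    (M ／ F).E.ncard < M.E.ncard := by
  obtain ⟨x, hx⟩ := Set.nonempty_iff_ne_empty.2 hne
  refine Set.ncard_lt_ncard ⟨Set.sdiff_subset, fun h => ?_⟩ (Set.toFinite _)
  exact (h (hF.subset_ground hx)).2 hx

open Classical in
/-- The Kazhdan-Lusztig polynomial `P_M` of a matroid, computed by recursion on the ground set.
In positive rank `r`, since `P_M` has degree `< r / 2`, its coefficient of `t ^ i` with `i < r / 2`
is the coefficient of `t ^ (r - i)` in `t ^ r * P_M(t⁻¹) - P_M(t)`, and the reciprocity condition
gives this difference as the sum of `χ_{M^F} * P_{M_F}` over the non-empty flats `F`.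
See `IsKazhdanLusztig.eq_klPoly`. -/
noncomputable def klPoly (M : Matroid α) : ℤ[X] :=
  if M.rkTop = 0 then (if M.E = ∅ then 1 else 0)
  else
    ∑ i ∈ Finset.range ((M.rkTop + 1) / 2),
      C ((∑ F : {F : Flats M // F.1 ≠ ∅},
        charPoly (M ↾ F.1.1) * klPoly (M ／ F.1.1)).coeff (M.rkTop - i)) * X ^ i
termination_by M.E.ncard
decreasing_by exact M.ncard_contract_ground_lt F.1.2 F.2

/-- The Kazhdan-Lusztig polynomials are the only ones that satisfy the three conditions. -/
theorem IsKazhdanLusztig.eq_klPoly {P : Matroid α → ℤ[X]} (hP : IsKazhdanLusztig P)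
    (M : Matroid α) : P M = klPoly M := by
  classical
  induction hn : M.E.ncard using Nat.strong_induction_on generalizing M with
  | _ n ih =>
  rw [klPoly]
  split_ifs with h0 hE
  · exact (hP.rank_zero M h0).1 hE
  · exact (hP.rank_zero M h0).2 hE
  have hpos : 0 < M.rkTop := Nat.pos_of_ne_zero h0
  have hdeg := hP.degree_lt M hpos
  have hS : (∑ F : {F : Flats M // F.1 ≠ ∅}, charPoly (M ↾ F.1.1) * klPoly (M ／ F.1.1))
      = ∑ F : {F : Flats M // F.1 ≠ ∅}, charPoly (M ↾ F.1.1) * P (M ／ F.1.1) := by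
    refine Finset.sum_congr rfl fun F _ => ?_
    rw [ih _ (hn ▸ M.ncard_contract_ground_lt F.1.2 F.2) _ rfl]
  rw [hS]
  have hrec := hP.reciprocity M
  rw [← Fintype.sum_subtype_add_sum_subtype (fun F : Flats M => F.1 ≠ ∅)] at hrec
  have hlow : ∀ m, M.rkTop ≤ 2 * m → (∑ F : {F : Flats M // ¬ F.1 ≠ ∅},
      charPoly (M ↾ F.1.1) * P (M ／ F.1.1)).coeff m = 0 := by
    intro m hm
    rw [finsetSum_coeff]
    refine Finset.sum_eq_zero fun F _ => ?_
    have hF : F.1.1 = ∅ := not_not.1 F.2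
    have hr : ∀ A, (M ↾ (∅ : Set α)).rkSet A = 0 := by
      intro A
      have : (M ↾ (∅ : Set α)).eRk A ≤ (M ↾ (∅ : Set α)).eRank := eRk_le_eRank _ _
      simp at this
      simp [rkSet, this]
    have hd : (charPoly (M ↾ (∅ : Set α))).natDegree = 0 := by
      rw [charPoly]
      split_ifs
      · rw [← Nat.le_zero]
        refine natDegree_sum_le_of_forall_le _ _ fun F _ => ?_
        rw [show (M ↾ (∅ : Set α)).rkTop = 0 from hr _, Nat.zero_sub, pow_zero, mul_one, natDegree_C]
      · simp
    rw [hF, contract_empty]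
    refine coeff_eq_zero_of_natDegree_lt (natDegree_mul_le.trans_lt ?_)
    omega
  ext i
  simp only [finsetSum_coeff, coeff_C_mul, coeff_X_pow, mul_ite, mul_one, mul_zero,
    Finset.sum_ite_eq, Finset.mem_range]
  split_ifs with hi
  · have := congrArg (fun p => p.coeff (M.rkTop - i)) hrec
    simp only [coeff_add, coeff_reflect] at this
    rw [hlow _ (by omega), revAt_le (by omega), add_zero,
      show M.rkTop - (M.rkTop - i) = i by omega] at this
    rw [this, finsetSum_coeff]
  · exact coeff_eq_zero_of_natDegree_lt (by omega)

/-- The `Z`-polynomial `Z_M(t) = ∑_F t ^ (rk F) * P_{M_F}(t)`. -/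
noncomputable def zPoly (M : Matroid α) : ℤ[X] :=
  ∑ F : Flats M, X ^ M.rkSet F.1 * klPoly (M ／ F.1)

end Invariants

/-- `g = ∑ γ_i t ^ i` gives the expansion
`f = ∑_{i ≤ d / 2} γ_i t ^ i (1 + t) ^ (d - 2 i)`, where `d` is the degree of `f`. -/
def IsGammaExpansion (f g : ℤ[X]) : Prop :=
  g.natDegree ≤ f.natDegree / 2 ∧
    f = ∑ i ∈ Finset.range (f.natDegree / 2 + 1),
      C (g.coeff i) * X ^ i * (1 + X) ^ (f.natDegree - 2 * i)

open Classical in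
/-- The `γ`-polynomial `γ(f, t)` of a palindromic polynomial `f` (and `0` if `f` is not
palindromic, in which case it has no such expansion). -/
noncomputable def gammaOf (f : ℤ[X]) : ℤ[X] :=
  if h : ∃ g, IsGammaExpansion f g then h.choose else 0

/-- The `γ`-polynomial of a matroid. -/
noncomputable def gammaPoly {α : Type*} [Finite α] (M : Matroid α) : ℤ[X] := gammaOf M.zPoly

/-- A matroid is `γ`-positive if its `γ`-polynomial has non-negative coefficients. -/
def IsGammaPositive {α : Type*} [Finite α] (M : Matroid α) : Prop :=
  ∀ i, 0 ≤ M.gammaPoly.coeff i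

/-- The uniform matroid `U_{k,n}` on `n` elements: a set is independent if it has at most `k`
elements. -/
noncomputable def uniform (k n : ℕ) : Matroid (Fin n) :=
  (IndepMatroid.ofFinite (E := Set.univ) Set.finite_univ (fun I => I.ncard ≤ k)
    (by simp)
    (fun _ _ hJ hIJ => (Set.ncard_le_ncard hIJ (Set.toFinite _)).trans hJ)
    (fun I J _ hJ hIJ => by
      obtain ⟨e, heJ, heI⟩ := Set.exists_mem_notMem_of_ncard_lt_ncard hIJ (Set.toFinite _)
      refine ⟨e, heJ, heI, ?_⟩
      rw [Set.ncard_insert_of_notMem heI (Set.toFinite _)]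
      omega)
    (fun _ _ => Set.subset_univ _)).matroid

/-- The bases of `U_{k,n}` are the `k`-element subsets. -/
theorem uniform_isBase_iff {k n : ℕ} (hkn : k ≤ n) (B : Set (Fin n)) :
    (uniform k n).IsBase B ↔ B.ncard = k := by
  have hind : ∀ I, (uniform k n).Indep I ↔ I.ncard ≤ k := fun I => Iff.rfl
  rw [isBase_iff_maximal_indep, maximal_iff]
  simp only [hind]
  constructor
  · rintro ⟨hB, hmax⟩
    by_contra hne
    obtain ⟨C, hBC, -, hC⟩ := Set.exists_subsuperset_card_eq (n := k) (Set.subset_univ B) hB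
      (by simpa [Set.ncard_univ] using hkn)
    exact hne (by rw [hmax hC.le hBC, hC])
  · intro hB
    exact ⟨hB.le, fun C hC hBC => Set.eq_of_subset_of_ncard_le hBC (by omega) (Set.toFinite _)⟩

end Matroid

/-!
A proper flat of a uniform matroid is a small subset: the restriction to it is Boolean, and the
contraction by it is uniform of the same corank. Hence a sum over proper flats is a binomial
transform, in the rank, of a sequence of polynomials, and binomial transforms compose like the
additive group of their parameter.

Deletion of an element suggests candidates for the Kazhdan-Lusztig polynomials, defined by recursion
on the corank. By Pascal's rule the corresponding `Z`-polynomial changes, from one corank to the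
next, by a `γ`-expansion with non-negative coefficients, starting from `(1 + t) ^ d`. So it is
palindromic, and its `γ`-polynomial is a sum of explicit terms, which is evaluated in closed form.
Inverting the binomial transform turns palindromicity into the Kazhdan-Lusztig reciprocity of the
candidates, and a closed form for their coefficients gives the degree bound, so that the candidates
are the Kazhdan-Lusztig polynomials.
-/

section BinomialTransform

open Finset

theorem choose_mul_choose_sub (n i j : ℕ) :
    n.choose i * (n - i).choose j = n.choose j * (n - j).choose i := by
  have hij := Nat.choose_mul (n := n) (Nat.le_add_right i j)
  have hji := Nat.choose_mul (n := n) (Nat.le_add_left j i)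
  rw [Nat.add_sub_cancel_left] at hij
  rw [Nat.add_sub_cancel_right] at hji
  rw [← hij, ← hji, Nat.choose_symm_add]

variable {R : Type*} [CommSemiring R]

/-- The transform `a ↦ (d ↦ ∑_j binom(m + d, j) x ^ j a_{d - j})` of sequences. When `a d` is an
invariant of the uniform matroid of rank `d` and corank `m`, this sums `x ^ rk F` times the
invariant of the contraction by `F` over the proper flats `F`, provided that `a 0 = 0`. -/
def binomialTransform (m : ℕ) (x : R) : (ℕ → R) →ₗ[R] ℕ → R where
  toFun a d := ∑ p ∈ antidiagonal d, (m + d).choose p.1 * x ^ p.1 * a p.2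
  map_add' a b := by ext d; simp [mul_add, sum_add_distrib]
  map_smul' c a := by ext d; simp [mul_sum, mul_left_comm]

theorem binomialTransform_apply (m : ℕ) (x : R) (a : ℕ → R) (d : ℕ) :
    binomialTransform m x a d = ∑ p ∈ antidiagonal d, (m + d).choose p.1 * x ^ p.1 * a p.2 :=
  rfl

theorem binomialTransform_congr {m : ℕ} {x : R} {a b : ℕ → R} {d : ℕ}
    (h : ∀ e ≤ d, a e = b e) : binomialTransform m x a d = binomialTransform m x b d := by
  simp only [binomialTransform_apply]
  exact sum_congr rfl fun p hp => by rw [h p.2 (HasAntidiagonal.antidiagonal.snd_le hp)]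

theorem binomialTransform_zero (m : ℕ) (a : ℕ → R) : binomialTransform m 0 a = a := by
  ext d
  rw [binomialTransform_apply, sum_eq_single_of_mem (0, d) (by simp)]
  · simp
  · rintro ⟨j, e⟩ hp hne
    have hj : j ≠ 0 := by rintro rfl; exact hne (by simpa using hp)
    simp [hj]

theorem binomialTransform_binomialTransform (m : ℕ) (x y : R) (a : ℕ → R) :
    binomialTransform m x (binomialTransform m y a) = binomialTransform m (x + y) a := by
  ext d
  simp only [binomialTransform_apply, (Commute.all x y).add_pow', nsmul_eq_mul, mul_sum, sum_mul,
    sum_sigma']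
  refine sum_nbij' (fun ⟨(i, _), (k, l)⟩ => ⟨(i + k, l), (i, k)⟩)
    (fun ⟨(_, l), (i, k)⟩ => ⟨(i, k + l), (k, l)⟩) ?_ ?_ ?_ ?_ ?_
  · rintro ⟨⟨i, j⟩, ⟨k, l⟩⟩ h
    obtain ⟨rfl, rfl⟩ : i + j = d ∧ k + l = j := by simpa using h
    simp [add_assoc]
  · rintro ⟨⟨s, l⟩, ⟨i, k⟩⟩ h
    obtain ⟨rfl, rfl⟩ : s + l = d ∧ i + k = s := by simpa using h
    simp [add_assoc]
  · rintro ⟨⟨i, j⟩, ⟨k, l⟩⟩ h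
    obtain ⟨-, rfl⟩ : i + j = d ∧ k + l = j := by simpa using h
    rfl
  · rintro ⟨⟨s, l⟩, ⟨i, k⟩⟩ h
    obtain ⟨-, rfl⟩ : s + l = d ∧ i + k = s := by simpa using h
    rfl
  · rintro ⟨⟨i, j⟩, ⟨k, l⟩⟩ h
    obtain ⟨rfl, rfl⟩ : i + j = d ∧ k + l = j := by simpa using h
    have hchoose := Nat.choose_mul (n := m + (i + (k + l))) (Nat.le_add_right i k)
    rw [Nat.add_sub_cancel_left, show m + (i + (k + l)) - i = m + (k + l) by omega] at hchoose
    have hcast := congrArg (Nat.cast (R := R)) hchoose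
    push_cast at hcast
    calc (m + (i + (k + l))).choose i * x ^ i * ((m + (k + l)).choose k * y ^ k * a l)
        = ((m + (i + (k + l))).choose i * (m + (k + l)).choose k) * (x ^ i * y ^ k * a l) := by ring
      _ = (m + (i + (k + l))).choose (i + k) * ((i + k).choose i * (x ^ i * y ^ k)) * a l := by
        rw [← hcast]; ring

theorem binomialTransform_pow (x y : R) (d : ℕ) :
    binomialTransform 0 x (fun e => y ^ e) d = (x + y) ^ d := by
  rw [binomialTransform_apply, (Commute.all x y).add_pow']
  refine sum_congr rfl fun p _ => ?_
  rw [zero_add, nsmul_eq_mul, mul_assoc]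

theorem binomialTransform_single_zero (m : ℕ) (x : R) (d : ℕ) :
    binomialTransform m x (Pi.single 0 1) d = (m + d).choose d * x ^ d := by
  rw [binomialTransform_apply, sum_eq_single_of_mem (d, 0) (by simp)]
  · simp
  · rintro ⟨j, e⟩ hp hne
    have he : e ≠ 0 := by rintro rfl; exact hne (by simpa using hp)
    simp [he]

theorem binomialTransform_choose (m k : ℕ) (x : R) (d : ℕ) :
    binomialTransform m x (fun e => ((m + e).choose (m + k) : R)) d =
      (m + d).choose (m + k) * (1 + x) ^ (d - k) := by
  have hpow : (1 + x) ^ (d - k) = ∑ j ∈ range (d + 1), x ^ j * (d - k).choose j := by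
    rw [add_comm, add_pow]
    simp only [one_pow, mul_one]
    refine sum_subset (range_subset_range.2 (by omega)) fun j _ hj => ?_
    rw [Nat.choose_eq_zero_of_lt (by simpa using hj), Nat.cast_zero, mul_zero]
  rw [hpow, binomialTransform_apply, mul_sum, Nat.sum_antidiagonal_eq_sum_range_succ_mk]
  refine sum_congr rfl fun j hj => ?_
  have hjd : j ≤ d := Nat.lt_succ_iff.1 (mem_range.1 hj)
  have hchoose := congrArg (Nat.cast (R := R)) (choose_mul_choose_sub (m + d) j (m + k))
  rw [Nat.add_sub_assoc hjd, Nat.add_sub_add_left] at hchoose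
  push_cast at hchoose
  calc (m + d).choose j * x ^ j * (m + (d - j)).choose (m + k)
      = ((m + d).choose j * (m + (d - j)).choose (m + k)) * x ^ j := by ring
    _ = (m + d).choose (m + k) * (x ^ j * (d - k).choose j) := by rw [hchoose]; ring

theorem binomialTransform_succ (m : ℕ) (x : R) {a : ℕ → R} (ha : a 0 = 0) :
    binomialTransform (m + 1) x a = binomialTransform m x (fun e => a e + x * a (e - 1)) := by
  ext d
  cases d with
  | zero => simp [binomialTransform_apply, ha]
  | succ d =>
    simp only [binomialTransform_apply, mul_add, sum_add_distrib]
    rw [Nat.sum_antidiagonal_succ, Nat.sum_antidiagonal_succ, Nat.sum_antidiagonal_succ']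
    simp only [Nat.choose_zero_right, Nat.zero_sub, Nat.add_sub_cancel, ha, mul_zero, zero_add]
    rw [add_assoc (_ * a (d + 1)), ← sum_add_distrib]
    congr 1
    refine sum_congr rfl fun p _ => ?_
    rw [add_right_comm m 1, Nat.choose_succ_succ']
    push_cast
    ring

end BinomialTransform

section GammaExpansion

variable {R : Type*}

/-- The polynomial `∑_{i ≤ d / 2} g_i t ^ i (1 + t) ^ (d - 2 i)`, which is palindromic of degree
`d` when `g_0 ≠ 0` and has `γ`-polynomial `g` when `g` has degree at most `d / 2`. -/
noncomputable def gammaExpansion [CommSemiring R] (d : ℕ) (g : R[X]) : R[X] :=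
  ∑ i ∈ Finset.range (d / 2 + 1), C (g.coeff i) * X ^ i * (1 + X) ^ (d - 2 * i)

section CommSemiring

variable [CommSemiring R]

theorem gammaExpansion_one (d : ℕ) : gammaExpansion d (1 : R[X]) = (1 + X) ^ d := by
  rw [gammaExpansion, Finset.sum_eq_single_of_mem 0 (by simp)]
  · simp
  · intro i _ hi
    simp [coeff_one, hi]

theorem gammaExpansion_add (d : ℕ) (g h : R[X]) :
    gammaExpansion d (g + h) = gammaExpansion d g + gammaExpansion d h := by
  simp only [gammaExpansion, coeff_add, C_add, add_mul, Finset.sum_add_distrib]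

theorem coeff_gammaExpansion {d i : ℕ} (g : R[X]) (hi : i ≤ d / 2) :
    (gammaExpansion d g).coeff i =
      ∑ l ∈ Finset.range i, g.coeff l * (d - 2 * l).choose (i - l) + g.coeff i := by
  have hterm (l : ℕ) : (C (g.coeff l) * X ^ l * (1 + X) ^ (d - 2 * l)).coeff i =
      if l ≤ i then g.coeff l * ((d - 2 * l).choose (i - l) : R) else 0 := by
    rw [mul_assoc, coeff_C_mul, coeff_X_pow_mul', coeff_one_add_X_pow]
    split_ifs <;> simp
  have hrange : (Finset.range (d / 2 + 1)).filter (· ≤ i) = Finset.range (i + 1) := by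
    ext l
    simp only [Finset.mem_filter, Finset.mem_range]
    omega
  simp only [gammaExpansion, finsetSum_coeff, hterm]
  rw [← Finset.sum_filter, hrange, Finset.sum_range_succ]
  simp

theorem reflect_sum {ι : Type*} (N : ℕ) (s : Finset ι) (f : ι → R[X]) :
    reflect N (∑ i ∈ s, f i) = ∑ i ∈ s, reflect N (f i) := by
  ext i
  simp only [coeff_reflect, finsetSum_coeff]

theorem reflect_one_add_X_pow (N : ℕ) : reflect N ((1 + X : R[X]) ^ N) = (1 + X) ^ N := by
  ext i
  rw [coeff_reflect, coeff_one_add_X_pow, coeff_one_add_X_pow]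
  rcases le_or_gt i N with h | h
  · rw [revAt_le h, Nat.choose_symm h]
  · rw [revAt_eq_self_of_lt h]

theorem natDegree_one_add_X_pow_le (N : ℕ) : ((1 + X : R[X]) ^ N).natDegree ≤ N :=
  (natDegree_pow_le_of_le N (m := 1) (by compute_degree)).trans_eq (mul_one N)

theorem reflect_gammaExpansion (d : ℕ) (g : R[X]) :
    reflect d (gammaExpansion d g) = gammaExpansion d g := by
  rw [gammaExpansion, reflect_sum]
  refine Finset.sum_congr rfl fun i hi => ?_
  have hid : 2 * i ≤ d := by have := Finset.mem_range.1 hi; omega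
  have hmul := reflect_mul (F := 2 * i) (G := d - 2 * i) (X ^ i : R[X]) ((1 + X) ^ (d - 2 * i))
    ((natDegree_X_pow_le i).trans (by omega)) (natDegree_one_add_X_pow_le _)
  rw [Nat.add_sub_cancel' hid, reflect_one_add_X_pow, reflect_monomial, revAt_le (by omega),
    show 2 * i - i = i by omega] at hmul
  rw [mul_assoc, reflect_C_mul, hmul]

theorem natDegree_gammaExpansion_le (d : ℕ) (g : R[X]) : (gammaExpansion d g).natDegree ≤ d := by
  refine natDegree_sum_le_of_forall_le _ _ fun i hi => ?_
  have := Finset.mem_range.1 hi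
  exact (natDegree_mul_le_of_le (natDegree_C_mul_X_pow_le _ _)
    (natDegree_one_add_X_pow_le _)).trans (by omega)

theorem natDegree_gammaExpansion (d : ℕ) {g : R[X]} (hg : g.coeff 0 ≠ 0) :
    (gammaExpansion d g).natDegree = d := by
  refine natDegree_eq_of_le_of_coeff_ne_zero (natDegree_gammaExpansion_le d g) ?_
  rw [← reflect_gammaExpansion, coeff_reflect, revAt_le le_rfl, Nat.sub_self,
    coeff_gammaExpansion g (Nat.zero_le _)]
  simpa using hg

end CommSemiring

theorem coeff_eq_of_gammaExpansion_eq [CommRing R] {d : ℕ} {g h : R[X]}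
    (hgh : gammaExpansion d g = gammaExpansion d h) {i : ℕ} (hi : i ≤ d / 2) :
    g.coeff i = h.coeff i := by
  induction i using Nat.strong_induction_on with
  | _ i ih =>
  have hcoeff := congrArg (fun p => p.coeff i) hgh
  simp only [coeff_gammaExpansion _ hi] at hcoeff
  rw [Finset.sum_congr rfl fun l hl => by
    have hl := Finset.mem_range.1 hl
    rw [ih l hl (hl.le.trans hi)]] at hcoeff
  exact add_left_cancel hcoeff

theorem gammaOf_gammaExpansion {d : ℕ} {g : ℤ[X]} (hdeg : g.natDegree ≤ d / 2)
    (hg : g.coeff 0 ≠ 0) : Matroid.gammaOf (gammaExpansion d g) = g := by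
  have hex : ∃ h, Matroid.IsGammaExpansion (gammaExpansion d g) h :=
    ⟨g, by rwa [natDegree_gammaExpansion d hg], by rw [natDegree_gammaExpansion d hg]; rfl⟩
  obtain ⟨hdeg', heq⟩ := hex.choose_spec
  rw [natDegree_gammaExpansion d hg] at hdeg' heq
  rw [Matroid.gammaOf, dif_pos hex]
  ext i
  rcases le_or_gt i (d / 2) with hi | hi
  · exact (coeff_eq_of_gammaExpansion_eq heq hi).symm
  · rw [coeff_eq_zero_of_natDegree_lt (hdeg'.trans_lt hi),
      coeff_eq_zero_of_natDegree_lt (hdeg.trans_lt hi)]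

end GammaExpansion

section UniformPolynomials

open Finset

/-- The leading coefficient that the deletion formula for Kazhdan-Lusztig polynomials attaches to
the uniform matroid of rank `2 p + 1` and corank `m + 1`, namely its coefficient of `t ^ p`. It is
indexed by `p + 1`, the exponent with which it enters the formula. -/
def uniformTau (m : ℕ) : ℕ → ℤ
  | 0 => 0
  | p + 1 => (m + 2 * p + 2).choose (p + 1) * (m + p).choose p -
      (m + 2 * p + 2).choose p * (m + p + 1).choose (p + 1)

theorem succ_mul_uniformTau (m p : ℕ) :
    ((p : ℤ) + 1) * uniformTau m (p + 1) = (m + 2 * p + 2).choose p * (m + p).choose p := by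
  have htop := Nat.choose_succ_right_eq (m + 2 * p + 2) p
  have hbot := Nat.add_one_mul_choose_eq (m + p) p
  rw [show m + 2 * p + 2 - p = m + p + 2 by omega] at htop
  zify at htop hbot
  rw [uniformTau]
  linear_combination ((m + p).choose p : ℤ) * htop + ((m + 2 * p + 2).choose p : ℤ) * hbot

theorem uniformTau_nonneg (m i : ℕ) : 0 ≤ uniformTau m i := by
  cases i with
  | zero => exact le_rfl
  | succ p =>
    refine nonneg_of_mul_nonneg_right (a := (p : ℤ) + 1) ?_ (by positivity)
    rw [succ_mul_uniformTau]
    positivity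

/-- The correction term of the deletion formula for the Kazhdan-Lusztig polynomial of the uniform
matroid of rank `d` and corank `m + 1`. The flats of rank `d - 2 i`, of which there are
`binom(m + d, m + 2 i)` after the deletion, contribute to the coefficient of `t ^ i`. -/
noncomputable def uniformDefect (m d : ℕ) : ℤ[X] :=
  ∑ i ∈ range (d / 2 + 1), C ((m + d).choose (m + 2 * i) * uniformTau m i) * X ^ i

theorem coeff_uniformDefect (m d i : ℕ) :
    (uniformDefect m d).coeff i = (m + d).choose (m + 2 * i) * uniformTau m i := by
  simp only [uniformDefect, finsetSum_coeff, coeff_C_mul, coeff_X_pow, mul_ite, mul_one, mul_zero,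
    Finset.sum_ite_eq, mem_range]
  split_ifs with h
  · rfl
  · rw [Nat.choose_eq_zero_of_lt (by omega), Nat.cast_zero, zero_mul]

theorem natDegree_uniformDefect_le (m d : ℕ) : (uniformDefect m d).natDegree ≤ d / 2 :=
  natDegree_sum_le_of_forall_le _ _ fun _ hi =>
    (natDegree_C_mul_X_pow_le _ _).trans (Nat.lt_succ_iff.1 (mem_range.1 hi))

theorem mul_coeff_uniformDefect (m a p : ℕ) :
    a * (uniformDefect m (a + p + 1)).coeff (p + 1) =
      a.choose (p + 1) * ((m + p).choose p * (m + (a + p + 1)).choose (m + p + 2)) := by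
  rw [coeff_uniformDefect]
  cases a with
  | zero => simp
  | succ a =>
    refine mul_left_cancel₀ (show (p : ℤ) + 1 ≠ 0 by positivity) ?_
    have hchoose := Nat.choose_mul (n := m + (a + 1 + p + 1)) (Nat.le_add_right (m + p + 2) p)
    rw [Nat.choose_symm_add, show m + (a + 1 + p + 1) - (m + p + 2) = a by omega,
      Nat.add_sub_cancel_left, show m + p + 2 + p = m + 2 * p + 2 by omega] at hchoose
    have habsorb := Nat.add_one_mul_choose_eq a p
    zify at hchoose habsorb
    push_cast
    linear_combination
      ((a : ℤ) + 1) * (m + (a + 1 + p + 1)).choose (m + 2 * p + 2) * succ_mul_uniformTau m p +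
      ((a : ℤ) + 1) * (m + p).choose p * hchoose +
      (m + p).choose p * (m + (a + 1 + p + 1)).choose (m + p + 2) * habsorb

theorem binomialTransform_uniformDefect (m d : ℕ) :
    binomialTransform m X (uniformDefect m) d = gammaExpansion d (uniformDefect m d) := by
  have hsum : ∀ e ≤ d, uniformDefect m e = (∑ i ∈ range (d / 2 + 1),
      (C (uniformTau m i) * X ^ i) • fun e => ((m + e).choose (m + 2 * i) : ℤ[X])) e := by
    intro e he
    rw [uniformDefect, Finset.sum_apply]
    refine (sum_subset (range_subset_range.2 (by omega)) fun i _ hi => ?_).trans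
      (sum_congr rfl fun i _ => ?_)
    · have hi : e / 2 + 1 ≤ i := by simpa using hi
      rw [Nat.choose_eq_zero_of_lt (by omega), Nat.cast_zero, zero_mul, C_0, zero_mul]
    · rw [Pi.smul_apply, smul_eq_mul, C_mul, map_natCast]
      ring
  rw [binomialTransform_congr hsum, map_sum, Finset.sum_apply, gammaExpansion]
  refine sum_congr rfl fun i _ => ?_
  rw [map_smul, Pi.smul_apply, smul_eq_mul, binomialTransform_choose, coeff_uniformDefect, C_mul,
    map_natCast]
  ring

/-- The Kazhdan-Lusztig polynomial of the uniform matroid of corank `m` and rank `d`, computed by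
deletion of an element. In rank `0` the value is `0`, which suits the use of `binomialTransform`
for sums over proper flats. -/
noncomputable def uniformKL : ℕ → ℕ → ℤ[X]
  | _, 0 => 0
  | 0, _ + 1 => 1
  | m + 1, d + 1 => uniformKL m (d + 1) - X * uniformKL (m + 1) d + uniformDefect m (d + 1)

theorem uniformKL_zero_right (m : ℕ) : uniformKL m 0 = 0 := by
  cases m <;> rw [uniformKL]

theorem uniformKL_succ (m d : ℕ) :
    uniformKL (m + 1) d = uniformKL m d - X * uniformKL (m + 1) (d - 1) + uniformDefect m d := by
  cases d with
  | zero => simp [uniformKL_zero_right, uniformDefect, uniformTau]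
  | succ d => rw [uniformKL, Nat.add_sub_cancel]

theorem coeff_zero_uniformKL (m d : ℕ) : (uniformKL m (d + 1)).coeff 0 = 1 := by
  induction m with
  | zero => rw [uniformKL, coeff_one_zero]
  | succ m ih =>
    rw [uniformKL_succ, coeff_add, coeff_sub, ih, coeff_X_mul_zero, coeff_uniformDefect,
      uniformTau, mul_zero, sub_zero, add_zero]

theorem coeff_uniformKL_of_le {m d i : ℕ} (h : d ≤ i) : (uniformKL m d).coeff i = 0 := by
  induction d generalizing m i with
  | zero => rw [uniformKL_zero_right, coeff_zero]
  | succ d ihd =>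
    obtain ⟨i, rfl⟩ : ∃ p, i = p + 1 := ⟨i - 1, by omega⟩
    induction m with
    | zero => rw [uniformKL, coeff_one, if_neg i.succ_ne_zero]
    | succ m ihm =>
      rw [uniformKL_succ, coeff_add, coeff_sub, ihm, coeff_X_mul, Nat.add_sub_cancel,
        ihd (Nat.le_of_succ_le_succ h), coeff_uniformDefect, Nat.choose_eq_zero_of_lt (by omega)]
      simp

theorem natDegree_uniformKL_le (m d : ℕ) : (uniformKL m d).natDegree ≤ d :=
  natDegree_le_iff_coeff_eq_zero.2 fun _ h => coeff_uniformKL_of_le h.le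

theorem sum_choose_mul_choose_add_sum (a p m : ℕ) :
    ∑ h ∈ range (m + 1), (a + h).choose (h + p + 2) * (p + h).choose h +
      ∑ h ∈ range (m + 1), (a + h).choose (h + p + 1) * (p + h - 1).choose h =
    (m + p).choose p * (a + m + 1).choose (m + p + 2) := by
  induction m with
  | zero => simp [Nat.choose_succ_succ' a (p + 1), add_comm, add_left_comm]
  | succ m ih =>
    have hsymm : (p + (m + 1)).choose (m + 1) = (m + 1 + p).choose p := by
      rw [add_comm p, Nat.choose_symm_add]
    have hpascal : (m + 1 + p).choose p = (m + p).choose p + (p + m).choose (m + 1) := by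
      rw [← hsymm, ← add_assoc p, Nat.choose_succ_succ', add_comm p, Nat.choose_symm_add]
    have hpascal' : (a + (m + 1) + 1).choose (m + 1 + p + 2) =
        (a + (m + 1)).choose (m + 1 + p + 1) + (a + (m + 1)).choose (m + 1 + p + 2) :=
      Nat.choose_succ_succ' _ _
    rw [sum_range_succ, sum_range_succ _ (m + 1), add_add_add_comm, ih, hpascal', hsymm,
      show p + (m + 1) - 1 = p + m by omega, hpascal, show m + 1 + p + 1 = m + p + 2 by omega,
      ← add_assoc a m 1]
    ring

theorem choose_mul_choose_eq_add (m a p : ℕ) (ha : 0 < a) :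
    a.choose (p + 1) * (m + (a + p + 1)).choose (m + p + 2) =
      (m + (a + p + 1)).choose (p + 1) * (a + m).choose (m + p + 2) +
      (m + (a + p + 1)).choose p * (a + m + 1).choose (m + p + 2) := by
  obtain ⟨a, rfl⟩ : ∃ b, a = b + 1 := ⟨a - 1, by omega⟩
  have hfst := choose_mul_choose_sub (m + (a + 1 + p + 1)) (m + p + 2) (p + 1)
  have hsnd := choose_mul_choose_sub (m + (a + 1 + p + 1)) (m + p + 2) p
  rw [show m + (a + 1 + p + 1) - (m + p + 2) = a by omega] at hfst hsnd
  rw [show m + (a + 1 + p + 1) - (p + 1) = a + 1 + m by omega] at hfst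
  rw [show m + (a + 1 + p + 1) - p = a + 1 + m + 1 by omega] at hsnd
  rw [Nat.choose_succ_succ', ← hfst, ← hsnd]
  ring

theorem mul_coeff_uniformKL_of_mul_coeff {a p : ℕ}
    (hp : ∀ m : ℕ, a * (uniformKL (m + 1) (a + p)).coeff p = (m + (a + p + 1)).choose p *
      ∑ h ∈ range (m + 1), ((a + h).choose (h + p + 1) * (p + h - 1).choose h : ℕ)) (m : ℕ) :
    a * (uniformKL m (a + p + 1)).coeff (p + 1) = (m + (a + p + 1)).choose (p + 1) *
      ∑ h ∈ range m, ((a + h).choose (h + p + 2) * (p + h).choose h : ℕ) := by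
  rcases Nat.eq_zero_or_pos a with rfl | ha
  · rw [sum_eq_zero fun h _ => by rw [Nat.choose_eq_zero_of_lt (by omega), zero_mul]]
    simp
  induction m with
  | zero => simp [uniformKL, coeff_one]
  | succ m ih =>
    have hdefect := mul_coeff_uniformDefect m a p
    have hsplit := choose_mul_choose_eq_add m a p ha
    have htelescope := sum_choose_mul_choose_add_sum a p m
    have hlast := sum_range_succ (fun h => (a + h).choose (h + p + 2) * (p + h).choose h) m
    have hpascal := Nat.choose_succ_succ' (m + (a + p + 1)) p
    have hsymm : (p + m).choose m = (m + p).choose p := by rw [add_comm, Nat.choose_symm_add]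
    rw [hsymm] at hlast
    rw [uniformKL_succ, coeff_add, coeff_sub, coeff_X_mul, Nat.add_sub_cancel, mul_add, mul_sub,
      ih, hp, hdefect, add_right_comm m 1, hpascal]
    zify at hsplit htelescope hlast ⊢
    linear_combination (m + p).choose p * hsplit - (m + (a + p + 1)).choose p * htelescope -
      (m + (a + p + 1)).choose (p + 1) * hlast

theorem mul_coeff_uniformKL (m a p : ℕ) :
    a * (uniformKL m (a + p + 1)).coeff (p + 1) = (m + (a + p + 1)).choose (p + 1) *
      ∑ h ∈ range m, ((a + h).choose (h + p + 2) * (p + h).choose h : ℕ) := by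
  induction p generalizing m with
  | zero =>
    refine mul_coeff_uniformKL_of_mul_coeff (p := 0) (fun m => ?_) m
    rw [sum_eq_single_of_mem 0 (by simp)]
    · cases a with
      | zero => simp
      | succ a => simp [coeff_zero_uniformKL]
    · intro h _ hh
      rw [Nat.choose_eq_zero_of_lt (n := 0 + h - 1) (by omega), mul_zero]
  | succ p ih =>
    refine mul_coeff_uniformKL_of_mul_coeff (fun m => ?_) m
    rw [← add_assoc, ih, show m + 1 + (a + p + 1) = m + (a + p + 1 + 1) by omega]
    congr 2
    refine sum_congr rfl fun h _ => ?_
    rw [show h + (p + 1) + 1 = h + p + 2 by omega, show p + 1 + h - 1 = p + h by omega]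

theorem coeff_uniformKL_eq_zero {m d i : ℕ} (hi : d ≤ 2 * i) : (uniformKL m d).coeff i = 0 := by
  rcases Nat.lt_or_ge i d with hid | hid
  · obtain ⟨p, rfl⟩ : ∃ p, i = p + 1 := ⟨i - 1, by omega⟩
    obtain ⟨a, rfl⟩ : ∃ a, d = a + p + 1 := ⟨d - (p + 1), by omega⟩
    have hcoeff := mul_coeff_uniformKL m a p
    rw [sum_eq_zero fun h _ => by rw [Nat.choose_eq_zero_of_lt (by omega), zero_mul],
      Nat.cast_zero, mul_zero] at hcoeff
    exact (mul_eq_zero.1 hcoeff).resolve_left (by omega)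
  · exact coeff_uniformKL_of_le hid

theorem two_mul_natDegree_uniformKL_lt {m d : ℕ} (hd : 0 < d) :
    2 * (uniformKL m d).natDegree < d := by
  by_contra! h
  have hlead : (uniformKL m d).leadingCoeff = 0 := coeff_uniformKL_eq_zero h
  rw [leadingCoeff_eq_zero.1 hlead, natDegree_zero] at h
  omega

/-- The `γ`-polynomial of the uniform matroid of corank `m` and rank `d`. -/
noncomputable def uniformGamma (m d : ℕ) : ℤ[X] := 1 + ∑ l ∈ range m, uniformDefect l d

theorem uniformGamma_succ (m d : ℕ) :
    uniformGamma (m + 1) d = uniformGamma m d + uniformDefect m d := by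
  rw [uniformGamma, sum_range_succ, ← add_assoc, uniformGamma]

theorem coeff_zero_uniformGamma (m d : ℕ) : (uniformGamma m d).coeff 0 = 1 := by
  simp [uniformGamma, coeff_uniformDefect, uniformTau]

theorem coeff_uniformGamma_nonneg (m d i : ℕ) : 0 ≤ (uniformGamma m d).coeff i := by
  rw [uniformGamma, coeff_add, finsetSum_coeff, coeff_one]
  refine add_nonneg (by split_ifs <;> simp) (sum_nonneg fun l _ => ?_)
  rw [coeff_uniformDefect]
  exact mul_nonneg (Nat.cast_nonneg _) (uniformTau_nonneg l i)

theorem natDegree_uniformGamma_le (m d : ℕ) : (uniformGamma m d).natDegree ≤ d / 2 :=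
  natDegree_add_le_of_degree_le (natDegree_one.trans_le (Nat.zero_le _))
    (natDegree_sum_le_of_forall_le _ _ fun l _ => natDegree_uniformDefect_le l d)

/-- The `Z`-polynomial of the uniform matroid of corank `m` and rank `d`. -/
noncomputable def uniformZ (m d : ℕ) : ℤ[X] := X ^ d + binomialTransform m X (uniformKL m) d

theorem uniformZ_zero (d : ℕ) : uniformZ 0 d = (1 + X) ^ d := by
  have hone : (fun e => 1 ^ e) = Pi.single 0 1 + uniformKL 0 := by
    ext1 e
    cases e <;> simp [uniformKL]
  rw [add_comm, ← binomialTransform_pow, hone, map_add, Pi.add_apply,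
    binomialTransform_single_zero, zero_add, Nat.choose_self, Nat.cast_one, one_mul, uniformZ]

/- Pascal's rule turns the step in the corank into a sum `P_{m + 1, e} + t P_{m + 1, e - 1}`, which
the deletion formula evaluates. -/
theorem uniformZ_succ (m d : ℕ) :
    uniformZ (m + 1) d = uniformZ m d + gammaExpansion d (uniformDefect m d) := by
  have hdeletion : (fun e => uniformKL (m + 1) e + X * uniformKL (m + 1) (e - 1)) =
      uniformKL m + uniformDefect m := by
    ext1 e
    rw [uniformKL_succ, Pi.add_apply]
    ring
  rw [uniformZ, binomialTransform_succ m X (uniformKL_zero_right _), hdeletion, map_add,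
    Pi.add_apply, binomialTransform_uniformDefect, ← add_assoc, uniformZ]

theorem uniformZ_eq_gammaExpansion (m d : ℕ) :
    uniformZ m d = gammaExpansion d (uniformGamma m d) := by
  induction m with
  | zero => rw [uniformZ_zero, uniformGamma, range_zero, sum_empty, add_zero, gammaExpansion_one]
  | succ m ih => rw [uniformZ_succ, ih, uniformGamma_succ, gammaExpansion_add]

end UniformPolynomials

section Reciprocity

open Finset

theorem reflect_binomialTransform_X {R : Type*} [CommSemiring R] (m : ℕ) {a : ℕ → R[X]}
    (ha : ∀ e, (a e).natDegree ≤ e) (d : ℕ) :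
    reflect d (binomialTransform m X a d) = binomialTransform m 1 (fun e => reflect e (a e)) d := by
  rw [binomialTransform_apply, binomialTransform_apply, reflect_sum]
  refine sum_congr rfl fun p hp => ?_
  have hmul := reflect_mul (X ^ p.1 : R[X]) (a p.2) (natDegree_X_pow_le p.1) (ha p.2)
  rw [HasAntidiagonal.mem_antidiagonal.1 hp, reflect_monomial, revAt_le le_rfl, Nat.sub_self,
    pow_zero, one_mul] at hmul
  rw [mul_assoc, ← C_eq_natCast, reflect_C_mul, hmul, one_pow, mul_one]

/-- The characteristic polynomial of the uniform matroid of corank `m` and positive rank `d`. -/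
noncomputable def uniformChar (m : ℕ) : ℕ → ℤ[X] := binomialTransform m (-1) fun e => X ^ e - 1

theorem uniformChar_zero {d : ℕ} (hd : 0 < d) : uniformChar 0 d = (X - 1) ^ d := by
  have hsub : (fun e => X ^ e - 1 : ℕ → ℤ[X]) = (fun e => X ^ e) - fun e => 1 ^ e := by
    ext1 e
    rw [Pi.sub_apply, one_pow]
  rw [uniformChar, hsub, map_sub, Pi.sub_apply, binomialTransform_pow, binomialTransform_pow,
    neg_add_cancel, zero_pow hd.ne', sub_zero, neg_add_eq_sub]

theorem reflect_uniformZ (m d : ℕ) : reflect d (uniformZ m d) = uniformZ m d := by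
  rw [uniformZ_eq_gammaExpansion, reflect_gammaExpansion]

/- Palindromicity of the `Z`-polynomials reads `T 1 (reflect P) = (t ^ d - 1) + T t P`, where `T` is
the binomial transform and `P` the sequence of Kazhdan-Lusztig polynomials. Now apply `T (-1)`. -/
theorem reflect_uniformKL (m d : ℕ) :
    reflect d (uniformKL m d) = uniformChar m d + binomialTransform m (X - 1) (uniformKL m) d := by
  have hpalindromic : binomialTransform m 1 (fun e => reflect e (uniformKL m e)) =
      (fun e => X ^ e - 1) + binomialTransform m X (uniformKL m) := by
    ext1 e
    have hreflect := reflect_uniformZ m e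
    rw [uniformZ, reflect_add, reflect_binomialTransform_X m (natDegree_uniformKL_le m),
      reflect_monomial, revAt_le le_rfl, Nat.sub_self, pow_zero] at hreflect
    rw [Pi.add_apply]
    linear_combination hreflect
  have hinvert := congrFun (congrArg (binomialTransform m (-1)) hpalindromic) d
  rwa [map_add, binomialTransform_binomialTransform, binomialTransform_binomialTransform,
    neg_add_cancel, binomialTransform_zero, neg_add_eq_sub, Pi.add_apply] at hinvert

end Reciprocity

section GammaCoefficients

open Finset

theorem sum_range_sub_mul_choose (q a : ℕ) :
    ∑ l ∈ range a, ((a : ℤ) - l) * (l + q).choose q = (a + q + 1).choose (q + 2) := by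
  induction a with
  | zero => simp
  | succ a ih =>
    have hsplit (l : ℕ) : (((a + 1 : ℕ) : ℤ) - l) * (l + q).choose q =
        ((a : ℤ) - l) * (l + q).choose q + ((l + q).choose q : ℕ) := by
      push_cast
      ring
    rw [sum_congr rfl fun l _ => hsplit l, sum_add_distrib, ← Nat.cast_sum,
      Nat.sum_range_add_choose, sum_range_succ, ih, sub_self, zero_mul, add_zero,
      add_right_comm a 1 q, Nat.choose_succ_succ' (a + q + 1), Nat.cast_add, add_comm]

theorem mul_coeff_uniformGamma (m a p : ℕ) :
    a * (uniformGamma m (a + p + 1)).coeff (p + 1) = a.choose (p + 1) *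
      ∑ l ∈ range a, ((a : ℤ) - l) * (p + l).choose p * (m + p + l).choose (p + l + 1) := by
  induction m with
  | zero =>
    rw [sum_eq_zero fun l _ => by
      rw [Nat.choose_eq_zero_of_lt (n := 0 + p + l) (by omega), Nat.cast_zero, mul_zero]]
    simp [uniformGamma, coeff_one]
  | succ m ih =>
    have hpascal (l : ℕ) :
        ((a : ℤ) - l) * (p + l).choose p * (m + 1 + p + l).choose (p + l + 1) =
          ((a : ℤ) - l) * (p + l).choose p * (m + p + l).choose (p + l + 1) +
          (m + p).choose p * (((a : ℤ) - l) * (l + (m + p)).choose (m + p)) := by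
      have hchoose := Nat.choose_mul (n := m + p + l) (Nat.le_add_left l p)
      rw [← Nat.choose_symm_add (a := p), Nat.add_sub_cancel, Nat.add_sub_cancel,
        ← Nat.choose_symm_add (a := m + p), add_comm (m + p) l] at hchoose
      rw [show m + 1 + p + l = l + (m + p) + 1 by omega, Nat.choose_succ_succ',
        show m + p + l = l + (m + p) by omega]
      zify at hchoose ⊢
      linear_combination ((a : ℤ) - l) * hchoose
    rw [sum_congr rfl fun l _ => hpascal l, sum_add_distrib, ← mul_sum, sum_range_sub_mul_choose,
      mul_add, ← ih, show a + (m + p) + 1 = m + (a + p + 1) by omega, ← mul_coeff_uniformDefect,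
      uniformGamma_succ, coeff_add, mul_add]

theorem coeff_uniformGamma (m k i : ℕ) (hi : 0 < i) (hik : i < k) :
    ((uniformGamma m k).coeff i : ℚ) =
      1 / ((k : ℚ) - i) * ((k - i).choose i : ℚ) *
        ∑ j ∈ Icc i (k - 1),
          ((k : ℚ) - j) * ((j - 1).choose (i - 1) : ℚ) * ((m + j - 1).choose j : ℚ) := by
  obtain ⟨p, rfl⟩ : ∃ p, i = p + 1 := ⟨i - 1, by omega⟩
  obtain ⟨a, rfl⟩ : ∃ a, k = a + p + 1 := ⟨k - (p + 1), by omega⟩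
  have hsub : ((a + p + 1 : ℕ) : ℚ) - (p + 1 : ℕ) = a := by push_cast; ring
  have hIcc : Icc (p + 1) (a + p + 1 - 1) = Ico (p + 1) (a + p + 1) := by
    ext j
    simp only [mem_Icc, mem_Ico]
    omega
  have hterm (l : ℕ) : (((a + p + 1 : ℕ) : ℚ) - (p + 1 + l : ℕ)) *
      ((p + 1 + l - 1).choose (p + 1 - 1) : ℚ) * ((m + (p + 1 + l) - 1).choose (p + 1 + l) : ℚ) =
      ((a : ℚ) - l) * (p + l).choose p * (m + p + l).choose (p + l + 1) := by
    rw [show p + 1 + l - 1 = p + l by omega, show p + 1 + l = p + l + 1 by omega,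
      show m + (p + l + 1) - 1 = m + p + l by omega, Nat.add_sub_cancel]
    push_cast
    ring
  have hcoeff := congrArg (Int.cast (R := ℚ)) (mul_coeff_uniformGamma m a p)
  push_cast at hcoeff
  have ha : (a : ℚ) ≠ 0 := by exact_mod_cast (show a ≠ 0 by omega)
  rw [hsub, show a + p + 1 - (p + 1) = a by omega, hIcc, sum_Ico_eq_sum_range,
    show a + p + 1 - (p + 1) = a by omega, sum_congr rfl fun l _ => hterm l, one_div, mul_assoc,
    ← hcoeff, inv_mul_cancel_left₀ ha]

end GammaCoefficients

section FlatLattice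

open Finset
open scoped Matroid

theorem mu_eq_of_sum_Icc_eq_zero {P R : Type*} [Ring R] [PartialOrder P] [LocallyFiniteOrder P]
    [DecidableEq P] {f : P → R} {a b : P} (ha : f a = 1)
    (hf : ∀ x, a < x → x ≤ b → ∑ y ∈ Icc a x, f y = 0) (hab : a ≤ b) :
    IncidenceAlgebra.mu R a b = f b := by
  induction hn : #(Icc a b) using Nat.strong_induction_on generalizing b with
  | _ n ih =>
  rcases hab.eq_or_lt with rfl | hlt
  · rw [IncidenceAlgebra.mu_self, ha]
  have hIco : ∑ y ∈ Ico a b, IncidenceAlgebra.mu R a y = ∑ y ∈ Ico a b, f y := by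
    refine sum_congr rfl fun y hy => ?_
    obtain ⟨hay, hyb⟩ := mem_Ico.1 hy
    exact ih _ (hn ▸ card_lt_card (Icc_ssubset_Icc_right hab le_rfl hyb))
      (fun x hax hxy => hf x hax (hxy.trans hyb.le)) hay rfl
  have hIcc := hf b hlt le_rfl
  rw [← Ico_insert_right hab, sum_insert right_notMem_Ico] at hIcc
  rw [IncidenceAlgebra.mu_eq_neg_sum_Ico_of_ne hlt.ne, hIco, eq_neg_of_add_eq_zero_left hIcc]

variable {α : Type*} {M : Matroid α}

theorem botFlat_le (F : M.Flats) : M.botFlat ≤ F :=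
  (M.closure_subset_closure (Set.empty_subset _)).trans_eq F.2.closure

theorem rkSet_botFlat (M : Matroid α) : M.rkSet M.botFlat.1 = 0 := by
  simp [Matroid.rkSet, Matroid.botFlat]

variable [Finite α]

open Classical in
theorem sum_mu_botFlat_eq_zero (hpos : 0 < M.rkTop) :
    ∑ F : M.Flats, IncidenceAlgebra.mu ℤ M.botFlat F = 0 := by
  have hne : M.botFlat ≠ ⟨M.E, M.ground_isFlat⟩ := by
    intro h
    have hrk : M.rkSet M.botFlat.1 = M.rkTop := congrArg (fun F : M.Flats => M.rkSet F.1) h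
    rw [rkSet_botFlat] at hrk
    exact hpos.ne hrk
  have hIcc : Icc M.botFlat ⟨M.E, M.ground_isFlat⟩ = univ :=
    eq_univ_of_forall fun F => mem_Icc.2 ⟨botFlat_le F, F.2.subset_ground⟩
  rw [← hIcc, IncidenceAlgebra.sum_Icc_mu_right, if_neg hne]

open Classical in
theorem charPoly_eq_sum_mul_sub_one (hM : M.Loopless) (hpos : 0 < M.rkTop) :
    M.charPoly = ∑ F : M.Flats,
      C (IncidenceAlgebra.mu ℤ M.botFlat F) * (X ^ (M.rkTop - M.rkSet F.1) - 1) := by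
  simp only [mul_sub, mul_one, sum_sub_distrib]
  rw [← map_sum, sum_mu_botFlat_eq_zero hpos, C_0, sub_zero, Matroid.charPoly, if_pos hM]

theorem klPoly_of_ground_eq_empty (hE : M.E = ∅) : M.klPoly = 1 := by
  have hrk : M.rkTop = 0 := by rw [Matroid.rkTop, Matroid.rkSet, hE, M.eRk_empty, ENat.toNat_zero]
  rw [Matroid.klPoly, if_pos hrk, if_pos hE]

open Classical in
theorem klPoly_eq_of_reflect_eq_sum {Q : ℤ[X]} (hdeg : 2 * Q.natDegree < M.rkTop)
    (hQ : reflect M.rkTop Q = ∑ F : M.Flats,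
      if F.1 = ∅ then Q else (M ↾ F.1).charPoly * (M ／ F.1).klPoly) :
    M.klPoly = Q := by
  have hcoeff (i : ℕ) (hi : i < (M.rkTop + 1) / 2) :
      (∑ F : {F : M.Flats // F.1 ≠ ∅},
        (M ↾ F.1.1).charPoly * (M ／ F.1.1).klPoly).coeff (M.rkTop - i) = Q.coeff i := by
    have hhigh : Q.coeff (M.rkTop - i) = 0 := coeff_eq_zero_of_natDegree_lt (by omega)
    have hreflect := congrArg (fun p => p.coeff (M.rkTop - i)) hQ
    simp only [coeff_reflect] at hreflect
    rw [revAt_le (Nat.sub_le _ _), Nat.sub_sub_self (by omega), sum_ite, coeff_add, sum_const,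
      coeff_smul, hhigh, smul_zero, zero_add] at hreflect
    rw [hreflect, sum_subtype _ fun F => mem_filter_univ F]
  ext i
  rw [Matroid.klPoly, if_neg (by omega)]
  simp only [finsetSum_coeff, coeff_C_mul_X_pow, Finset.sum_ite_eq, mem_range]
  split_ifs with hi
  · rw [← finsetSum_coeff, hcoeff i hi]
  · rw [coeff_eq_zero_of_natDegree_lt (by omega)]

end FlatLattice

section UniformMatroid

open Finset
open scoped Matroid

variable {α : Type*}

/-- `M` is a uniform matroid of rank `d` and corank `m` on its ground set. -/
structure IsUniformMatroid (M : Matroid α) (d m : ℕ) : Prop where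
  ncard_ground : M.E.ncard = d + m
  indep_iff : ∀ I ⊆ M.E, M.Indep I ↔ I.ncard ≤ d

theorem isUniformMatroid_uniform {k n : ℕ} (hkn : k ≤ n) :
    IsUniformMatroid (Matroid.uniform k n) k (n - k) where
  ncard_ground := by
    change (Set.univ : Set (Fin n)).ncard = _
    rw [Set.ncard_univ, Nat.card_fin, Nat.add_sub_cancel' hkn]
  indep_iff _ _ := Iff.rfl

namespace IsUniformMatroid

variable {M : Matroid α} {d m : ℕ}

theorem rkSet_eq_ncard (h : IsUniformMatroid M d m) {F : Set α} (hFE : F ⊆ M.E)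
    (hF : F.ncard ≤ d) : M.rkSet F = F.ncard := by
  rw [Matroid.rkSet, ((h.indep_iff F hFE).2 hF).eRk_eq_encard, Set.ncard_def]

variable [Finite α]

theorem mem_closure_iff (h : IsUniformMatroid M d m) {J : Set α} (hJE : J ⊆ M.E)
    (hJ : J.ncard ≤ d) {e : α} (heE : e ∈ M.E) (heJ : e ∉ J) : e ∈ M.closure J ↔ d ≤ J.ncard := by
  rw [← not_iff_not, ((h.indep_iff J hJE).2 hJ).notMem_closure_iff_of_notMem heJ heE,
    h.indep_iff _ (Set.insert_subset heE hJE), Set.ncard_insert_of_notMem heJ, not_le]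
  exact Nat.succ_le_iff

theorem isFlat_of_ncard_lt (h : IsUniformMatroid M d m) {F : Set α} (hFE : F ⊆ M.E)
    (hF : F.ncard < d) : M.IsFlat F := by
  rw [Matroid.isFlat_iff_closure_eq]
  refine (M.subset_closure F hFE).antisymm' fun e he => ?_
  by_contra heF
  exact hF.not_ge ((h.mem_closure_iff hFE hF.le (M.closure_subset_ground F he) heF).1 he)

theorem eq_ground_of_isFlat (h : IsUniformMatroid M d m) {F : Set α} (hF : M.IsFlat F)
    (hd : d ≤ F.ncard) : F = M.E := by
  refine hF.subset_ground.antisymm fun e heE => ?_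
  by_contra heF
  obtain ⟨J, hJF, hJ⟩ := Set.exists_subset_card_eq hd
  have heJ : e ∈ M.closure J := (h.mem_closure_iff (hJF.trans hF.subset_ground) hJ.le heE
    fun he => heF (hJF he)).2 hJ.ge
  exact heF (hF.closure ▸ M.closure_subset_closure hJF heJ)

theorem rkTop_eq (h : IsUniformMatroid M d m) : M.rkTop = d := by
  obtain ⟨J, hJE, hJ⟩ := Set.exists_subset_card_eq (s := M.E) (n := d)
    (by rw [h.ncard_ground]; omega)
  have hrk : M.eRk M.E = d := by
    refine le_antisymm (Matroid.eRk_le_iff.2 fun I hIE hI => ?_) ?_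
    · rw [← Set.Finite.cast_ncard_eq (Set.toFinite I)]
      exact_mod_cast (h.indep_iff I hIE).1 hI
    · rw [← hJ, Set.Finite.cast_ncard_eq (Set.toFinite J)]
      exact ((h.indep_iff J hJE).2 hJ.le).encard_le_eRk_of_subset hJE
  rw [Matroid.rkTop, Matroid.rkSet, hrk, ENat.toNat_natCast]

theorem restrict (h : IsUniformMatroid M d m) {F : Set α} (hFE : F ⊆ M.E) (hF : F.ncard ≤ d) :
    IsUniformMatroid (M ↾ F) F.ncard 0 where
  ncard_ground := rfl
  indep_iff I (hIF : I ⊆ F) := by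
    have hcard : I.ncard ≤ F.ncard := Set.ncard_le_ncard hIF
    rw [Matroid.restrict_indep_iff, h.indep_iff I (hIF.trans hFE)]
    exact ⟨fun _ => hcard, fun _ => ⟨hcard.trans hF, hIF⟩⟩

theorem contract (h : IsUniformMatroid M d m) {F : Set α} (hFE : F ⊆ M.E) (hF : F.ncard ≤ d) :
    IsUniformMatroid (M ／ F) (d - F.ncard) m where
  ncard_ground := by
    rw [Matroid.contract_ground, Set.ncard_sdiff hFE, h.ncard_ground]
    omega
  indep_iff I hI := by
    obtain ⟨hIE, hIF⟩ := Set.subset_sdiff.1 hI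
    rw [((h.indep_iff F hFE).2 hF).contract_indep_iff, h.indep_iff _ (Set.union_subset hIE hFE),
      Set.ncard_union_eq hIF, and_iff_right hIF, Nat.le_sub_iff_add_le hF]

theorem card_flats_of_ncard_eq (h : IsUniformMatroid M d m) {j : ℕ} (hj : j < d) :
    {F : M.Flats | F.1.ncard = j}.ncard = (m + d).choose j := by
  rw [← Set.ncard_image_of_injective _ Subtype.val_injective, add_comm m, ← h.ncard_ground,
    ← Set.ncard_powerset_ncard (Set.toFinite _)]
  congr 1
  ext F
  constructor
  · rintro ⟨F, hF, rfl⟩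
    exact ⟨F.2.subset_ground, hF⟩
  · rintro ⟨hFE, hF⟩
    exact ⟨⟨F, h.isFlat_of_ncard_lt hFE (hF.trans_lt hj)⟩, hF, rfl⟩

theorem sum_flats {R : Type*} [CommSemiring R] (h : IsUniformMatroid M d m) {x : R} {a : ℕ → R}
    (ha : a 0 = 0) {f : M.Flats → R}
    (hf : ∀ F : M.Flats, F.1.ncard < d → f F = x ^ F.1.ncard * a (d - F.1.ncard)) :
    ∑ F : M.Flats, f F = binomialTransform m x a d + f ⟨M.E, M.ground_isFlat⟩ := by
  have htop : ({F : M.Flats | ¬F.1.ncard < d} : Finset M.Flats) = {⟨M.E, M.ground_isFlat⟩} := by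
    ext F
    rw [mem_filter_univ, mem_singleton, not_lt]
    refine ⟨fun hF => Subtype.ext (h.eq_ground_of_isFlat F.2 hF), ?_⟩
    rintro rfl
    exact (Nat.le_add_right d m).trans_eq h.ncard_ground.symm
  rw [← sum_filter_add_sum_filter_not _ fun F : M.Flats => F.1.ncard < d, htop, sum_singleton,
    binomialTransform_apply, Nat.sum_antidiagonal_eq_sum_range_succ_mk, sum_range_succ,
    Nat.sub_self, ha, mul_zero, add_zero]
  congr 1
  rw [← sum_fiberwise_of_maps_to (t := range d) (g := fun F : M.Flats => F.1.ncard)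
    fun F hF => mem_range.2 (mem_filter.1 hF).2]
  refine sum_congr rfl fun j hj => ?_
  have hj := mem_range.1 hj
  have hfiber : #{F ∈ {F : M.Flats | F.1.ncard < d} | F.1.ncard = j} = (m + d).choose j := by
    rw [← h.card_flats_of_ncard_eq hj, ← Set.ncard_coe_finset]
    congr 1
    ext F
    simp only [coe_filter, mem_filter_univ, Set.mem_ofPred_eq, and_iff_right_iff_imp]
    exact fun hF => hF.trans_lt hj
  rw [sum_eq_card_nsmul fun F hF => ?_, hfiber, nsmul_eq_mul, mul_assoc]
  obtain ⟨hFd, rfl⟩ := mem_filter.1 hF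
  exact hf F ((mem_filter_univ F).1 hFd)

theorem botFlat_eq_empty (h : IsUniformMatroid M d m) (hd : 0 < d) : M.botFlat.1 = ∅ :=
  (h.isFlat_of_ncard_lt (Set.empty_subset _) (by rwa [Set.ncard_empty])).closure

theorem loopless (h : IsUniformMatroid M d m) (hd : 0 < d) : M.Loopless :=
  ⟨h.botFlat_eq_empty hd⟩

open Classical in
theorem sum_Icc_botFlat_neg_one_pow (h : IsUniformMatroid M d m) {F : M.Flats}
    (hF : F.1.ncard < d) (hlt : M.botFlat < F) :
    ∑ G ∈ Icc M.botFlat F, (-1 : ℤ) ^ G.1.ncard = 0 := by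
  have hnonempty : (Set.toFinite F.1).toFinset.Nonempty := by
    rw [Set.Finite.toFinset_nonempty, Set.nonempty_iff_ne_empty, ← h.botFlat_eq_empty (by omega)]
    exact fun heq => hlt.ne' (Subtype.ext heq)
  have hsub {S : Finset α} (hS : S ∈ (Set.toFinite F.1).toFinset.powerset) : (S : Set α) ⊆ F.1 :=
    Set.Finite.subset_toFinset.1 (mem_powerset.1 hS)
  rw [← Finset.sum_powerset_neg_one_pow_card_of_nonempty hnonempty]
  refine sum_bij' (fun G _ => (Set.toFinite G.1).toFinset)
    (fun S hS => ⟨S, h.isFlat_of_ncard_lt ((hsub hS).trans F.2.subset_ground)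
      ((Set.ncard_le_ncard (hsub hS)).trans_lt hF)⟩) ?_ ?_ ?_ ?_ ?_
  · intro G hG
    exact mem_powerset.2 (Set.Finite.toFinset_subset_toFinset.2 (mem_Icc.1 hG).2)
  · intro S hS
    exact mem_Icc.2 ⟨botFlat_le _, hsub hS⟩
  · intro G _
    exact Subtype.ext (Set.Finite.coe_toFinset _)
  · intro S _
    exact Finset.coe_injective (Set.Finite.coe_toFinset _)
  · intro G _
    rw [Set.ncard_eq_toFinset_card]

open Classical in
theorem mu_botFlat_eq (h : IsUniformMatroid M d m) {F : M.Flats} (hF : F.1.ncard < d) :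
    IncidenceAlgebra.mu ℤ M.botFlat F = (-1) ^ F.1.ncard := by
  refine mu_eq_of_sum_Icc_eq_zero (f := fun G : M.Flats => (-1 : ℤ) ^ G.1.ncard) ?_
    (fun G hG hGF => ?_) (botFlat_le F)
  · rw [h.botFlat_eq_empty (by omega), Set.ncard_empty, pow_zero]
  · exact h.sum_Icc_botFlat_neg_one_pow ((Set.ncard_le_ncard hGF).trans_lt hF) hG

theorem charPoly_eq (h : IsUniformMatroid M d m) (hd : 0 < d) : M.charPoly = uniformChar m d := by
  classical
  have hpos : 0 < M.rkTop := by rwa [h.rkTop_eq]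
  rw [charPoly_eq_sum_mul_sub_one (h.loopless hd) hpos,
    h.sum_flats (x := -1) (a := fun e => X ^ e - 1) (by simp) fun F hF => ?_]
  · rw [← Matroid.rkTop, Nat.sub_self, pow_zero, sub_self, mul_zero, add_zero, uniformChar]
  · rw [h.mu_botFlat_eq hF, h.rkTop_eq, h.rkSet_eq_ncard F.2.subset_ground hF.le, C_pow, C_neg, C_1]

theorem klPoly_eq (h : IsUniformMatroid M d m) (hd : 0 < d) : M.klPoly = uniformKL m d := by
  classical
  induction d using Nat.strong_induction_on generalizing M with
  | _ d ih =>
  refine klPoly_eq_of_reflect_eq_sum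
    ((two_mul_natDegree_uniformKL_lt hd).trans_eq h.rkTop_eq.symm) ?_
  have hE : M.E ≠ ∅ := (Set.nonempty_of_ncard_ne_zero (by rw [h.ncard_ground]; omega)).ne_empty
  rw [h.rkTop_eq, reflect_uniformKL,
    h.sum_flats (x := X - 1) (uniformKL_zero_right m) fun F hF => ?_]
  · rw [if_neg hE, Matroid.restrict_ground_eq_self, h.charPoly_eq hd,
      klPoly_of_ground_eq_empty (by simp), mul_one, add_comm]
  split_ifs with hF0
  · rw [hF0, Set.ncard_empty, pow_zero, one_mul, Nat.sub_zero]
  · have hpos : 0 < F.1.ncard := (Set.ncard_pos).2 (Set.nonempty_iff_ne_empty.2 hF0)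
    have hFE := F.2.subset_ground
    rw [(h.restrict hFE hF.le).charPoly_eq hpos, uniformChar_zero hpos,
      ih _ (by omega) (h.contract hFE hF.le) (by omega)]

theorem zPoly_eq (h : IsUniformMatroid M d m) : M.zPoly = uniformZ m d := by
  classical
  rw [Matroid.zPoly, h.sum_flats (x := X) (uniformKL_zero_right m) fun F hF => ?_]
  · rw [← Matroid.rkTop, h.rkTop_eq, klPoly_of_ground_eq_empty (by simp), mul_one, add_comm,
      uniformZ]
  · rw [h.rkSet_eq_ncard F.2.subset_ground hF.le,
      (h.contract F.2.subset_ground hF.le).klPoly_eq (by omega)]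

theorem gammaPoly_eq (h : IsUniformMatroid M d m) : M.gammaPoly = uniformGamma m d := by
  rw [Matroid.gammaPoly, h.zPoly_eq, uniformZ_eq_gammaExpansion]
  refine gammaOf_gammaExpansion (natDegree_uniformGamma_le m d) ?_
  rw [coeff_zero_uniformGamma]
  exact one_ne_zero

end IsUniformMatroid

end UniformMatroid

theorem mainTheorem9_general {α : Type*} [Finite α] {M : Matroid α} {k m : ℕ}
    (h : IsUniformMatroid M k m) :
    M.IsGammaPositive ∧ M.gammaPoly.natDegree ≤ k / 2 ∧ M.gammaPoly.coeff 0 = 1 ∧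
      ∀ i : ℕ, 0 < i → i < k →
        (M.gammaPoly.coeff i : ℚ) =
          1 / ((k : ℚ) - i) * ((k - i).choose i : ℚ) *
            ∑ j ∈ Finset.Icc i (k - 1),
              ((k : ℚ) - j) * ((j - 1).choose (i - 1) : ℚ) * ((m + j - 1).choose j : ℚ) := by
  rw [Matroid.IsGammaPositive, h.gammaPoly_eq]
  exact ⟨coeff_uniformGamma_nonneg m k, natDegree_uniformGamma_le m k,
    coeff_zero_uniformGamma m k, coeff_uniformGamma m k⟩

theorem mainTheorem9 (k n : ℕ) (hkn : k ≤ n) :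
    (Matroid.uniform k n).IsGammaPositive ∧
    (Matroid.uniform k n).gammaPoly.natDegree ≤ k / 2 ∧
    (Matroid.uniform k n).gammaPoly.coeff 0 = 1 ∧
    ∀ i : ℕ, 0 < i → i < k →
      ((Matroid.uniform k n).gammaPoly.coeff i : ℚ) =
        1 / ((k : ℚ) - i) * ((k - i).choose i : ℚ) *
          ∑ j ∈ Finset.Icc i (k - 1),
            ((k : ℚ) - j) * ((j - 1).choose (i - 1) : ℚ) * ((n - k + j - 1).choose j : ℚ) :=
  mainTheorem9_general (isUniformMatroid_uniform hkn)
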